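/- **Conventions.** A vector code of length $n$ over a field $\mathbb F$ with $|\mathbb F|=q$ is a linear subspace $\mathcal C\subseteq(\mathbb F^\alpha)^n$; its $n$ symbols (nodes) lie in $\mathbb F^\alpha$, $K=\dim_{\mathbb F}\mathcal C$, and $d_{\min}$ is the minimum number of nodes in which two distinct codewords differ. An $((n_\ell,r,d),(\alpha,\beta),K_\ell)$ MBR code is a vector code of length $n_\ell$ and dimension $K_\ell$ with $\alpha=d\beta$ and $K_\ell=\bigl(rd-\binom r2\bigr)\beta$ in which any $r$ nodes determine the codeword, and any node can be recovered from $\beta$ scalars (linear functions of the stored content) downloaded from each of any $d$ other nodes. The product-matrix (PM) MBR code with distinct evaluation points $x_1,\dots,x_{n_\ell}$ and $\beta=1$ consists of the words $(\psi(x_t)M)_t$, where $\psi(x)=(1,x,\dots,x^{d-1})$ and $M$ ranges over the symmetric $d\times d$ matrices whose lower right $(d-r)\times(d-r)$ block is $0$; for general $\beta$ one takes $\beta$ independent stripes of this code. **Parameters.** Let $1\le r\le d\le n_\ell-1$, $\beta\ge1$, $n\geq 1$, $n_\ell\mid n$, $\nu=n/n_\ell$, $\alpha=d\beta$, $K_\ell=\bigl(rd-\binom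 r2\bigr)\beta$. Put $a_i=\alpha-(i-1)\beta$ for $1\le i\le r$, $a_i=0$ for $r<i\le n_\ell$, $b_{i+jn_\ell}=a_i$ for $1\le i\le n_\ell$, $j\ge0$, and $P(s)=\sum_{i=1}^s b_i$; let $P^{\rm inv}(x)$ be the least $y$ with $P(y)\ge x$. Let $K_\ell\le K\le\nu K_\ell$ be rate-optimal, that is, $K=P(s)$ for some $s\ge1$. **The code.** Let $x_0,\dots,x_{n-1}\in\mathbb F$ be distinct. For $0\le i<\nu$ let the $i$-th local group consist of the nodes $t\equiv i\pmod\nu$, and let $f^{(i)}$ be the monic polynomial whose roots are the points $x_t$ of that group. Write $K=aK_\ell+b$ with $1\le b\le K_\ell$, and let $p=P^{\rm inv}(b)$. For $\beta=1$, the lifted MBR code consists of all words whose symbol at each node $t$ of group $i$ is $\psi(x_t)M^{(i)}$, where $M^{(0)},\dots,M^{(\nu-1)}$ are PM message matrices such that for each column $j\in\{0,\dots,d-1\}$ the unique polynomial of degree less than $n$ that is congruent to $\sum_t M^{(i)}_{j,t}X^t$ modulo $f^{(i)}$ for all $i$ has degree at most $an_\ell+d-1$ if $j<p$ and at most $an_\ell+p-1$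 if $j\ge p$. For general $\beta$ it consists of $\beta$ independent stripes of this code. **Theorem.** (i) Over every finite field $\mathbb F$ with $n\mid q-1$ (for instance with $q=n+1$ whenever $n+1$ is a prime power) there is a primitive $n$-th root of unity, and for every such root $\gamma$ the lifted MBR code with the evaluation points $x_t=\gamma^t$ is an $(n,K,d_{\min},\alpha)$ vector code that meets the bound $d_{\min}\le n-P^{\rm inv}(K)+1$ with equality, $$d_{\min}=n-P^{\rm inv}(K)+1 .$$ The $\nu$ local groups are disjoint, have $n_\ell$ nodes each and cover all nodes; the restriction of the code to each of them is the PM MBR code with the evaluation points of that group, and it is an $((n_\ell,r,d),(\alpha,\beta),K_\ell)$ MBR code of minimum distance at least $n_\ell-r+1$. (ii) For fixed local length $n_\ell$, the field size can be taken linear in $n$ for all parameters: for every $n_\ell$ there is a constant $c$ such that for all $n,r,d,\beta,K$ as above there are a finite field $\mathbb F$ with $q\le c\,n$ and distinct points $x_0,\dots,x_{n-1}\in\mathbb F$ for which the lifted MBR code has all the properties listed in (i). -/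

import Mathlib

open Polynomial

/-! ### Vector codes -/

/-- A vector code over `F` whose code symbols (thick columns) are indexed by `ι`, each code symbol
being a vector of `α = |κ|` scalars, the coordinates of which are indexed by `κ`. Its scalar
dimension is its dimension over `F`. -/
abbrev VectorCode (F ι κ : Type*) [Field F] := Submodule F (ι → κ → F)

namespace VectorCode

variable {F ι κ : Type*} [Field F]

/-- The code `C|_S` obtained by restricting `C` to the thick columns in `S`. -/
def restrict (C : VectorCode F ι κ) (S : Finset ι) : VectorCode F S κ :=
  Submodule.map (LinearMap.funLeft F (κ → F) (Subtype.val : S → ι)) C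

open scoped Classical in
/-- The set of all Hamming distances (at the level of thick columns) of two distinct codewords. -/
noncomputable def distances [Fintype ι] (C : VectorCode F ι κ) : Set ℕ :=
  {w | ∃ x ∈ C, ∃ y ∈ C, x ≠ y ∧ w = hammingDist x y}

/-- `C` has minimum distance (exactly) `w`. -/
def HasMinDist [Fintype ι] (C : VectorCode F ι κ) (w : ℕ) : Prop :=
  IsLeast C.distances w

/-- `C` is an `((n, k, d), (α, β), B)` regenerating code: it has `n` nodes that store `α` scalars
each and dimension (file size) `B`; the content of any `k` nodes determines the codeword, and the
content of any node `f` is a function of `β` scalars downloaded from each of any `d` other nodes.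
All maps are linear. -/
structure IsRegenerating [Fintype ι] [Fintype κ] (C : VectorCode F ι κ) (n k d α β B : ℕ) :
    Prop where
  card_nodes : Fintype.card ι = n
  card_symbol : Fintype.card κ = α
  beta_le : β ≤ α
  file_size : Module.finrank F C = B
  reconstruct : ∀ S : Finset ι, S.card = k →
    ∀ x ∈ C, ∀ y ∈ C, (∀ i ∈ S, x i = y i) → x = y
  repair : ∀ (f : ι) (D : Finset ι), f ∉ D → D.card = d →
    ∃ (download : D → (κ → F) →ₗ[F] (Fin β → F)) (recover : (D → Fin β → F) →ₗ[F] (κ → F)),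
      ∀ c ∈ C, c f = recover (fun i => download i (c i))

/-- An `((n, k, d), (α, β), B)` MBR code: a regenerating code at the minimum-bandwidth point
`α = d β`, `B = (k d - k (k - 1) / 2) β`. -/
structure IsMBR [Fintype ι] [Fintype κ] (C : VectorCode F ι κ) (n k d α β B : ℕ) : Prop
    extends IsRegenerating C n k d α β B where
  alpha_eq : α = d * β
  size_eq : B = (k * d - k.choose 2) * β

/-- `C` has disjoint `(r, nl - r + 1)` all-symbol locality with respect to the groups `S i`, and
the local codes are `((nl, r, d), (α, β), Kl)` MBR codes. -/
structure HasMBRLocality [Fintype κ] (C : VectorCode F ι κ) {ν : ℕ} (S : Fin ν → Finset ι)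
    (nl r d α β Kl : ℕ) : Prop where
  pairwise_disjoint : ∀ i j, i ≠ j → Disjoint (S i) (S j)
  cover : ∀ t, ∃ i, t ∈ S i
  card_group : ∀ i, (S i).card = nl
  local_dist : ∀ i, ∀ w ∈ (C.restrict (S i)).distances, nl - r + 1 ≤ w
  local_mbr : ∀ i, (C.restrict (S i)).IsMBR nl r d α β Kl

end VectorCode

/-! ### Rank accumulation of MBR codes -/

/-- The file size `Kl` of an `((nl, r, d), (α, β), Kl)` MBR code. -/
def mbrSize (r d β : ℕ) : ℕ := (r * d - r.choose 2) * β

/-- The MBR rank profile, indexed from `0`: this is `a_{i+1}`, where `a_i = α - (i - 1) β` for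
`1 ≤ i ≤ r` and `a_i = 0` for `i > r`, and `α = d β`. (For `i < r ≤ d` the subtraction does not
truncate.) -/
def mbrRankProfile (r d β i : ℕ) : ℕ := if i < r then d * β - i * β else 0

/-- `P(s) = b_1 + ⋯ + b_s`, where `b_{i + j nl} = a_i` for `1 ≤ i ≤ nl` and `j ≥ 0`. -/
def leadingSum (nl r d β s : ℕ) : ℕ := ∑ t ∈ Finset.range s, mbrRankProfile r d β (t % nl)

/-- `P^inv(x)`, the smallest `y` such that `P(y) ≥ x`. -/
noncomputable def leadingSumInv (nl r d β x : ℕ) : ℕ := sInf {y | x ≤ leadingSum nl r d β y}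

/-! ### Product-matrix MBR codes -/

section

variable (F : Type*) [Field F]

/-- The message matrices of the product-matrix MBR framework: symmetric `d × d` matrices whose
lower right `(d - r) × (d - r)` block vanishes. -/
def pmMessage (r d : ℕ) : Submodule F (Matrix (Fin d) (Fin d) F) where
  carrier := {M | M.IsSymm ∧ ∀ i j : Fin d, r ≤ (i : ℕ) → r ≤ (j : ℕ) → M i j = 0}
  add_mem' := by
    rintro A B ⟨hA, hA'⟩ ⟨hB, hB'⟩
    refine ⟨hA.add hB, fun i j hi hj => ?_⟩
    simp [hA' i j hi hj, hB' i j hi hj]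
  zero_mem' := ⟨Matrix.isSymm_zero, fun _ _ _ _ => rfl⟩
  smul_mem' := by
    rintro c A ⟨hA, hA'⟩
    refine ⟨hA.smul c, fun i j hi hj => ?_⟩
    simp [hA' i j hi hj]

variable {F}

/-- The row vector `ψ = [1, x, x², …, x^(d-1)]`. -/
def psi (d : ℕ) (x : F) : Fin d → F := fun t => x ^ (t : ℕ)

/-- The product-matrix MBR code with evaluation points `x`: node `i` stores `ψ(x i) M` for a
message matrix `M`. For general `β` there are `β` independent message matrices (stripes), and
node `i` stores `α = d β` scalars; `β = 1` is the basic code. -/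
def pmMBRCode {ι : Type*} (r d β : ℕ) (x : ι → F) : VectorCode F ι (Fin β × Fin d) where
  carrier := {c | ∃ M : Fin β → Matrix (Fin d) (Fin d) F, (∀ l, M l ∈ pmMessage F r d) ∧
    ∀ i l j, c i (l, j) = Matrix.vecMul (psi d (x i)) (M l) j}
  add_mem' := by
    rintro c c' ⟨M, hM, hc⟩ ⟨M', hM', hc'⟩
    refine ⟨fun l => M l + M' l, fun l => add_mem (hM l) (hM' l), fun i l j => ?_⟩
    simp [Matrix.vecMul_add, hc, hc']
  zero_mem' := ⟨fun _ => 0, fun _ => zero_mem _, by simp⟩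
  smul_mem' := by
    rintro a c ⟨M, hM, hc⟩
    refine ⟨fun l => a • M l, fun l => Submodule.smul_mem _ a (hM l), fun i l j => ?_⟩
    simp [Matrix.vecMul_smul, hc]

/-! ### Lifting across the local groups -/

/-- The `ν = n / nl` local groups: group `i` consists of the nodes `t ≡ i` modulo `ν`. -/
def localGroup (n nl : ℕ) (i : Fin (n / nl)) : Finset (Fin n) :=
  Finset.univ.filter fun t => (t : ℕ) % (n / nl) = (i : ℕ)

/-- The annihilating polynomial `f^(i)` of the evaluation points of local group `i`. -/
noncomputable def annihilator (n nl : ℕ) (x : Fin n → F) (i : Fin (n / nl)) : F[X] :=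
  ∏ t ∈ localGroup n nl i, (X - C (x t))

/-- The polynomial `m_j(X) = ∑ t, M_{j,t} X^t` of column `j` of a (symmetric) matrix `M`. -/
noncomputable def columnPoly {d : ℕ} (M : Matrix (Fin d) (Fin d) F) (j : Fin d) : F[X] :=
  ∑ t : Fin d, C (M j t) * X ^ (t : ℕ)

/-- `G` is the lift of the polynomials `m i`: the polynomial of degree less than `n` that reduces
to `m i` modulo `f^(i)` for all `i` (unique if the points `x` are distinct). -/
def IsLift (n nl : ℕ) (x : Fin n → F) (m : Fin (n / nl) → F[X]) (G : F[X]) : Prop :=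
  G.degree < (n : ℕ) ∧ ∀ i, G %ₘ annihilator n nl x i = m i

/-- The quotient `a` in `K = a Kl + b` with `1 ≤ b ≤ Kl` (for `1 ≤ K`). -/
def liftQuot (r d β K : ℕ) : ℕ := (K - 1) / mbrSize r d β

/-- The remainder `b` in `K = a Kl + b` with `1 ≤ b ≤ Kl` (for `1 ≤ K`). -/
def liftRem (r d β K : ℕ) : ℕ := K - liftQuot r d β K * mbrSize r d β

/-- The bound (exclusive) on the degree of the lifted polynomial of column `j`: with
`p = P^inv(b)`, the degree is at most `a nl + d - 1` for `j < p` and at most `a nl + p - 1` for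
`p ≤ j`. -/
noncomputable def degreeCap (nl r d β K j : ℕ) : ℕ :=
  if j < leadingSumInv nl r d β (liftRem r d β K) then liftQuot r d β K * nl + d
  else liftQuot r d β K * nl + leadingSumInv nl r d β (liftRem r d β K)

/-- The lifted MBR code with evaluation points `x`. A codeword is given (for each of the `β`
stripes `l`) by message matrices `M l i`, one for each local group `i`, such that for each column
`j` the lift of the column polynomials `m_j^(i)` obeys the degree cap. Node `t` of local group `i`
stores the vectors `ψ(x t) (M l i)`. -/
def liftedMBRCode (n nl r d β K : ℕ) (x : Fin n → F) :
    VectorCode F (Fin n) (Fin β × Fin d) where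
  carrier := {c | ∃ M : Fin β → Fin (n / nl) → Matrix (Fin d) (Fin d) F,
    (∀ l i, M l i ∈ pmMessage F r d) ∧
    (∀ l j, ∃ G : F[X], IsLift n nl x (fun i => columnPoly (M l i) j) G ∧
      G.degree < (degreeCap nl r d β K j : ℕ)) ∧
    ∀ i, ∀ t ∈ localGroup n nl i, ∀ l j,
      c t (l, j) = Matrix.vecMul (psi d (x t)) (M l i) j}
  add_mem' := by
    rintro c c' ⟨M, hM, hG, hc⟩ ⟨M', hM', hG', hc'⟩
    refine ⟨fun l i => M l i + M' l i, fun l i => add_mem (hM l i) (hM' l i), fun l j => ?_,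
      fun i t ht l j => ?_⟩
    · obtain ⟨G, ⟨h1, h2⟩, h3⟩ := hG l j
      obtain ⟨G', ⟨h1', h2'⟩, h3'⟩ := hG' l j
      refine ⟨G + G', ⟨(degree_add_le _ _).trans_lt (max_lt h1 h1'), fun i => ?_⟩,
        (degree_add_le _ _).trans_lt (max_lt h3 h3')⟩
      rw [add_modByMonic, h2, h2']
      simp [columnPoly, add_mul, Finset.sum_add_distrib]
    · simp [Matrix.vecMul_add, hc i t ht, hc' i t ht]
  zero_mem' := by
    refine ⟨fun _ _ => 0, fun _ _ => zero_mem _, fun l j => ⟨0, ⟨?_, fun i => ?_⟩, ?_⟩, by simp⟩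
    · simp
    · simp [columnPoly]
    · simp
  smul_mem' := by
    rintro a c ⟨M, hM, hG, hc⟩
    refine ⟨fun l i => a • M l i, fun l i => Submodule.smul_mem _ a (hM l i), fun l j => ?_,
      fun i t ht l j => ?_⟩
    · obtain ⟨G, ⟨h1, h2⟩, h3⟩ := hG l j
      refine ⟨a • G, ⟨(degree_smul_le _ _).trans_lt h1, fun i => ?_⟩,
        (degree_smul_le _ _).trans_lt h3⟩
      rw [smul_modByMonic, h2]
      simp [columnPoly, Finset.smul_sum, smul_eq_C_mul, mul_assoc]
    · simp [Matrix.vecMul_smul, hc i t ht]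

/-! ### The parameters and the properties of the code -/

/-- The admissible parameters: `1 ≤ r ≤ d ≤ nl - 1`, `nl ∣ n`, `β ≥ 1`, and a rate-optimal
dimension `K`, that is, `Kl ≤ K ≤ ν Kl` and `K = P(s)` for some `s ≥ 1`. -/
structure AdmissibleParams (n nl r d β K : ℕ) : Prop where
  one_le_r : 1 ≤ r
  r_le_d : r ≤ d
  d_lt_nl : d < nl
  n_pos : 0 < n
  nl_dvd_n : nl ∣ n
  one_le_beta : 1 ≤ β
  size_le_K : mbrSize r d β ≤ K
  K_le : K ≤ n / nl * mbrSize r d β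
  rate_optimal : ∃ s, 1 ≤ s ∧ K = leadingSum nl r d β s

/-- `𝒞` is a vector code of length `n`, dimension `K` and minimum distance
`n - P^inv(K) + 1`, it has disjoint `((nl, r, d), (d β, β), Kl)` MBR locality with respect to the
groups `localGroup n nl`, and its local codes are the product-matrix MBR codes with the (distinct)
evaluation points `x`. -/
structure IsOptimalMBRLocalityCode (n nl r d β K : ℕ) (x : Fin n → F)
    (𝒞 : VectorCode F (Fin n) (Fin β × Fin d)) : Prop where
  points_distinct : Function.Injective x
  dimension : Module.finrank F 𝒞 = K
  min_dist : 𝒞.HasMinDist (n - leadingSumInv nl r d β K + 1)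
  mbr_locality :
    𝒞.HasMBRLocality (localGroup n nl) nl r d (d * β) β (mbrSize r d β)
  local_eq_pm : ∀ i, 𝒞.restrict (localGroup n nl i) =
    pmMBRCode r d β (fun t : localGroup n nl i => x t)

end

/-!
The evaluation points are chosen such that every local group is a fibre of `X ↦ X^nl`: if `y i` is
the value of this map on group `i`, then `f^(i) = X^nl - y i`, and reduction modulo `f^(i)` is the
substitution `X^(nl u + s) ↦ (y i)^u X^s`. Hence the `ν` local message matrices of a codeword are
the values at `y 0, …, y (ν - 1)` of one matrix polynomial `N_0 + N_1 Y + ⋯` of degree below `ν`.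
The `y i` being distinct, each `N_u` inherits the symmetry and the zero block of the local message
matrices (`IsLift.coeff_eq`, `liftedMBRCode_le_range`). The degree caps of the columns then mean
exactly that `N_u = 0` for `u > a` and that `N_a` is a message matrix for the parameter `p` in place
of `r`. So the lifted code is the image of an encoder `blockEncoder` whose messages are `a` message
matrices for `r` and one for `p`, for each stripe. The product-matrix code is the case `a = 0`,
`p = r`.

The encoder is injective even on any `a nl + p` nodes (`eq_zero_of_eval_blockPoly`): if a codeword
vanishes there, the polynomials of the columns `j ≥ p` vanish because of their degree; by symmetry,
the entries in the rows `j ≥ p` of the other columns vanish as well, so that the polynomials of these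
columns also have degree below `a nl + p`. This gives the dimension `a Kl + P(p) = K` and the lower
bound on the distance, as `P^inv(K) = a nl + p`; for `a = 0` it gives the reconstruction property and
the distance of the local codes. A rank one matrix times a polynomial in `X^nl` yields a codeword
that attains the bound (`exists_mem_range_blockEncoder`). Repair is the usual product-matrix
argument (`pmMBRCode_repair`).

For the points `γ^t` the groups are the cosets of the subgroup of order `nl` of `⟨γ⟩`. For a field
size linear in `n` it is enough that `q ≡ 1` modulo `nl` and `q > n`, since then there are at least
`ν` cosets of the group of `nl`-th roots of unity; the powers of `p ^ φ(nl)`, for a prime `p > nl`,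
are such field sizes (`exists_field_card_le`).
-/

/-! ### The rank accumulation profile -/

/-- Both sides count the free entries of a message matrix: the left one row by row. -/
theorem sum_range_sub_eq (d : ℕ) {r : ℕ} (h : r ≤ d) :
    ∑ i ∈ Finset.range r, (d - i) = r * d - r.choose 2 := by
  have key : ∀ r ≤ d, ∑ i ∈ Finset.range r, (d - i) + r.choose 2 = r * d := by
    intro r
    induction r with
    | zero => simp
    | succ r ih =>
      intro h
      have h1 := ih (by omega)
      have h2 : (r + 1).choose 2 = r + r.choose 2 := by
        rw [Nat.choose_succ_succ' r 1, Nat.choose_one_right]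
      rw [Finset.sum_range_succ, h2, add_mul, one_mul]
      omega
  have := key r h
  omega

theorem mbrSize_eq_sum {r d : ℕ} (β : ℕ) (h : r ≤ d) :
    mbrSize r d β = ∑ i ∈ Finset.range r, (d - i) * β := by
  rw [mbrSize, ← sum_range_sub_eq d h, Finset.sum_mul]

theorem mbrSize_strictMono {p r d β : ℕ} (hβ : 1 ≤ β) (hpr : p < r) (hr : r ≤ d) :
    mbrSize p d β < mbrSize r d β := by
  rw [mbrSize_eq_sum β hr, mbrSize_eq_sum β (hpr.le.trans hr)]
  refine Finset.sum_lt_sum_of_subset (i := p) (by simpa using hpr.le) (by simpa) (by simp) ?_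
    (by simp)
  exact Nat.mul_pos (by omega) hβ

theorem mbrSize_zero (d β : ℕ) : mbrSize 0 d β = 0 := by simp [mbrSize]

theorem mbrSize_mono {p r d β : ℕ} (hβ : 1 ≤ β) (hpr : p ≤ r) (hr : r ≤ d) :
    mbrSize p d β ≤ mbrSize r d β := by
  rcases hpr.eq_or_lt with rfl | h
  · rfl
  · exact (mbrSize_strictMono hβ h hr).le

/-- Within one period the leading sum is the file size of an MBR code with smaller `r`. -/
theorem leadingSum_of_le {nl r d p : ℕ} (β : ℕ) (hr : r ≤ d) (hp : p ≤ nl) :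
    leadingSum nl r d β p = mbrSize (min p r) d β := by
  rw [mbrSize_eq_sum β ((min_le_right _ _).trans hr), leadingSum]
  induction p with
  | zero => simp
  | succ p ih =>
    rw [Finset.sum_range_succ, ih (by omega), Nat.mod_eq_of_lt (by omega), mbrRankProfile]
    split_ifs with h
    · rw [min_eq_left (by omega), min_eq_left (by omega), Finset.sum_range_succ, Nat.sub_mul]
    · rw [min_eq_right (by omega), min_eq_right (by omega), add_zero]

theorem leadingSum_add {nl r d β : ℕ} (hr : r ≤ d) (hnl : r ≤ nl) (q p : ℕ) :
    leadingSum nl r d β (q * nl + p) = q * mbrSize r d β + leadingSum nl r d β p := by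
  induction q with
  | zero => simp
  | succ q ih =>
    have h : (q + 1) * nl + p = nl + (q * nl + p) := by ring
    rw [h, leadingSum, Finset.sum_range_add]
    simp only [Nat.add_mod_left]
    change leadingSum nl r d β nl + leadingSum nl r d β (q * nl + p) = _
    rw [ih, leadingSum_of_le β hr le_rfl, min_eq_right hnl]
    ring

theorem leadingSum_mono (nl r d β : ℕ) : Monotone (leadingSum nl r d β) := fun _ _ h =>
  Finset.sum_le_sum_of_subset (by simpa using h)

theorem leadingSumInv_leadingSum {nl r d β s : ℕ}
    (h : leadingSum nl r d β s < leadingSum nl r d β (s + 1)) :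
    leadingSumInv nl r d β (leadingSum nl r d β (s + 1)) = s + 1 := by
  refine IsLeast.csInf_eq ⟨le_refl (leadingSum nl r d β (s + 1)), fun z hz => ?_⟩
  by_contra! hlt
  exact absurd (hz.trans (leadingSum_mono nl r d β (Nat.le_of_lt_succ hlt))) (not_le.2 h)

theorem leadingSumInv_eq {nl r d β p : ℕ} (hβ : 1 ≤ β) (hr : r ≤ d) (hnl : r ≤ nl) (q : ℕ)
    (hp : 1 ≤ p) (hpr : p ≤ r) :
    leadingSumInv nl r d β (q * mbrSize r d β + mbrSize p d β) = q * nl + p := by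
  obtain ⟨p, rfl⟩ := Nat.exists_eq_add_of_le' hp
  have h1 : ∀ p' ≤ r, leadingSum nl r d β (q * nl + p') =
      q * mbrSize r d β + mbrSize p' d β := fun p' h => by
    rw [leadingSum_add hr hnl, leadingSum_of_le β hr (h.trans hnl), min_eq_left h]
  rw [← h1 _ hpr, ← add_assoc]
  refine leadingSumInv_leadingSum ?_
  rw [add_assoc, h1 _ hpr, h1 p (by omega)]
  have := mbrSize_strictMono (p := p) hβ (Nat.lt_add_one p) (hpr.trans hr)
  omega

/-- The shape of a rate-optimal dimension: `K` is `a` full periods plus the first `p` terms of the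
next one, with `1 ≤ p ≤ r`; the quotient and remainder of `K` and both values of `P^inv` can be
read off. The last clause is what makes the local codes full. -/
theorem AdmissibleParams.exists_shape {n nl r d β K : ℕ} (h : AdmissibleParams n nl r d β K) :
    ∃ p, 1 ≤ p ∧ p ≤ r ∧ K = liftQuot r d β K * mbrSize r d β + mbrSize p d β ∧
      leadingSumInv nl r d β (liftRem r d β K) = p ∧
      leadingSumInv nl r d β K = liftQuot r d β K * nl + p ∧
      liftQuot r d β K < n / nl ∧ (liftQuot r d β K = 0 → p = r) := by
  obtain ⟨hr1, hrd, hdn, -, -, hβ, hK1, hK2, s, hs1, hs⟩ := h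
  have hrn : r ≤ nl := by omega
  have hpos : ∀ p, 1 ≤ p → p ≤ r → 0 < mbrSize p d β := fun p h1 h2 => by
    simpa [mbrSize_zero] using mbrSize_strictMono (p := 0) (β := β) hβ h1 (h2.trans hrd)
  have hKl := hpos r hr1 le_rfl
  obtain ⟨q, p, hp1, hpr, hqp⟩ : ∃ q p, 1 ≤ p ∧ p ≤ r ∧
      K = q * mbrSize r d β + mbrSize p d β := by
    have e : K = s / nl * mbrSize r d β + mbrSize (min (s % nl) r) d β := by
      rw [← leadingSum_of_le β hrd (Nat.mod_lt s (by omega)).le, ← leadingSum_add hrd hrn,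
        Nat.div_add_mod', hs]
    rcases Nat.eq_zero_or_pos (s % nl) with h0 | h0
    · rw [h0, Nat.zero_min, mbrSize_zero, add_zero] at e
      obtain ⟨q, hq⟩ : ∃ q, s / nl = q + 1 := Nat.exists_eq_succ_of_ne_zero (by
        rintro h; rw [h] at e; omega)
      exact ⟨q, r, hr1, le_rfl, by rw [e, hq]; ring⟩
    · exact ⟨s / nl, min (s % nl) r, by omega, min_le_right _ _, e⟩
  have hple : mbrSize p d β ≤ mbrSize r d β := mbrSize_mono hβ hpr hrd
  have hp0 := hpos p hp1 hpr
  have hq : liftQuot r d β K = q := by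
    rw [liftQuot, Nat.div_eq_iff hKl]
    rw [mul_comm] at hqp
    constructor <;> rw [mul_comm] <;> omega
  have hb : liftRem r d β K = mbrSize p d β := by
    rw [liftRem, hq]; omega
  refine ⟨p, hp1, hpr, by rw [hq]; exact hqp, ?_, ?_, ?_, ?_⟩
  · simpa [hb] using leadingSumInv_eq hβ hrd hrn 0 hp1 hpr
  · rw [hq]
    exact hqp ▸ leadingSumInv_eq hβ hrd hrn q hp1 hpr
  · rw [hq]
    by_contra! hlt
    have := Nat.mul_le_mul_right (mbrSize r d β) hlt
    omega
  · rw [hq]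
    rintro rfl
    by_contra hne
    have := mbrSize_strictMono (p := p) hβ (lt_of_le_of_ne hpr hne) hrd
    omega

/-! ### Minimum distance from reconstruction sets -/

namespace VectorCode

variable {F ι κ : Type*} [Field F] [Fintype ι] {C : VectorCode F ι κ} {k : ℕ}

theorem lt_of_mem_distances (hrec : ∀ S : Finset ι, S.card = k →
    ∀ x ∈ C, ∀ y ∈ C, (∀ i ∈ S, x i = y i) → x = y) {w : ℕ} (hw : w ∈ C.distances) :
    Fintype.card ι < w + k := by
  classical
  obtain ⟨x, hx, y, hy, hne, rfl⟩ := hw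
  by_contra! hle
  have hc := Finset.card_filter_add_card_filter_not (s := Finset.univ) (fun i => x i ≠ y i)
  obtain ⟨S, hS, hcard⟩ := Finset.exists_subset_card_eq (n := k)
    (s := Finset.univ.filter fun i => ¬ x i ≠ y i) (by
      rw [Finset.card_univ] at hc
      have : hammingDist x y = (Finset.univ.filter fun i => x i ≠ y i).card := by
        unfold hammingDist; congr
      omega)
  exact hne (hrec S hcard x hx y hy fun i hi => by simpa using hS hi)

/-- If any `k` nodes determine the codeword while some nonzero codeword vanishes on `k - 1` nodes,
the minimum distance is `n - k + 1`. -/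
theorem hasMinDist_of_reconstruct (hrec : ∀ S : Finset ι, S.card = k →
    ∀ x ∈ C, ∀ y ∈ C, (∀ i ∈ S, x i = y i) → x = y)
    (Z : Finset ι) (hZ : Z.card + 1 = k) {c : ι → κ → F} (hc : c ∈ C) (hc0 : c ≠ 0)
    (hcZ : ∀ i ∈ Z, c i = 0) : C.HasMinDist (Fintype.card ι - k + 1) := by
  classical
  have hZlt : Z.card < Fintype.card ι := by
    rw [← Finset.card_univ]
    refine Finset.card_lt_card (Finset.ssubset_univ_iff.2 ?_)
    rintro rfl
    exact hc0 (funext fun i => hcZ i (Finset.mem_univ i))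
  have hlow : ∀ w ∈ C.distances, Fintype.card ι - k + 1 ≤ w := fun w hw => by
    have := lt_of_mem_distances hrec hw
    omega
  refine ⟨?_, hlow⟩
  have hmem : hammingDist c 0 ∈ C.distances :=
    ⟨c, hc, 0, C.zero_mem, hc0, by unfold hammingDist; congr⟩
  have h1 := hlow _ hmem
  have h2 : hammingDist c 0 ≤ Fintype.card ι - Z.card := by
    rw [← Finset.card_compl]
    refine Finset.card_le_card fun i hi => ?_
    simp only [Finset.mem_filter, Finset.mem_compl] at hi ⊢
    exact fun h => hi.2 (hcZ i h)
  have h3 : 0 < hammingDist c 0 := hammingDist_pos.2 hc0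
  have h5 : hammingDist c 0 = Fintype.card ι - k + 1 := by omega
  rwa [← h5]

end VectorCode

/-! ### Message matrices and their column polynomials -/

section Messages

variable {F : Type*} [Field F] {d : ℕ}

/-- A message matrix is determined by the entries `(i, j)` with `i < r` and `i ≤ j`, and these are
arbitrary. -/
def pmMessageEquiv (F : Type*) [Field F] {r d : ℕ} (h : r ≤ d) :
    pmMessage F r d ≃ₗ[F] ((Σ i : Fin r, {j : Fin d // (i : ℕ) ≤ j}) → F) where
  toFun M q := M.1 (Fin.castLE h q.1) q.2
  map_add' _ _ := rfl
  map_smul' _ _ := rfl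
  invFun v := ⟨Matrix.of fun i j => if hij : min (i : ℕ) j < r then
      v ⟨⟨min (i : ℕ) j, hij⟩, ⟨max i j, (min_le_left _ _).trans (le_max_left i j)⟩⟩ else 0, by
    refine ⟨?_, fun i j hi hj => ?_⟩
    · ext i j
      simp only [Matrix.transpose_apply, Matrix.of_apply, min_comm (j : ℕ) i, max_comm j i]
      split_ifs
      · congr! 3 <;> rw [min_comm (j : ℕ)]
      · rfl
    · rw [Matrix.of_apply, dif_neg (not_lt.2 (le_min hi hj))]⟩
  left_inv := by
    rintro ⟨M, hM, hM0⟩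
    ext i j
    simp only [Matrix.of_apply]
    split_ifs with hij
    · rcases le_total i j with e | e
      · simp [e]
      · have e' : min (i : ℕ) j = j := min_eq_right e
        simpa [e, e'] using hM.apply i j
    · exact (hM0 i j ((not_lt.1 hij).trans (min_le_left _ _))
        ((not_lt.1 hij).trans (min_le_right _ _))).symm
  right_inv := by
    intro v
    ext ⟨i, j, hij⟩
    have e : Fin.castLE h i ≤ j := hij
    have e' : min (i : ℕ) j = i := min_eq_left hij
    simp only [Matrix.of_apply, Fin.val_castLE]
    rw [dif_pos (by rw [e']; exact i.2)]
    congr! 3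
    · rw [e']
    · exact max_eq_right e

theorem finrank_pmMessage {r : ℕ} (h : r ≤ d) :
    Module.finrank F (pmMessage F r d) = r * d - r.choose 2 := by
  have hc : ∀ i : Fin r, Fintype.card {j : Fin d // (i : ℕ) ≤ j} = d - i := fun i => by
    rw [Fintype.card_subtype]
    have := Fin.card_Ici (n := d) (Fin.castLE h i)
    rw [Fin.val_castLE] at this
    rw [← this]
    congr 1
    ext j
    simp [Fin.le_def]
  rw [(pmMessageEquiv F h).finrank_eq, Module.finrank_fintype_fun_eq_card, Fintype.card_sigma,
    ← sum_range_sub_eq d h, Finset.sum_range]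
  exact Finset.sum_congr rfl fun i _ => hc i

theorem pmMessage_mono {p r : ℕ} (h : p ≤ r) : pmMessage F p d ≤ pmMessage F r d :=
  fun _ hM => ⟨hM.1, fun i j hi hj => hM.2 i j (h.trans hi) (h.trans hj)⟩

theorem coeff_columnPoly (M : Matrix (Fin d) (Fin d) F) (j t : Fin d) :
    (columnPoly M j).coeff t = M j t := by
  simp only [columnPoly, finsetSum_coeff, coeff_C_mul_X_pow]
  rw [Finset.sum_eq_single t] <;> simp +contextual [Fin.ext_iff, eq_comm]

theorem coeff_columnPoly_of_le (M : Matrix (Fin d) (Fin d) F) (j : Fin d) {s : ℕ} (h : d ≤ s) :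
    (columnPoly M j).coeff s = 0 := by
  simp only [columnPoly, finsetSum_coeff, coeff_C_mul_X_pow]
  exact Finset.sum_eq_zero fun t _ => if_neg (by omega)

theorem degree_columnPoly_lt (M : Matrix (Fin d) (Fin d) F) (j : Fin d) :
    (columnPoly M j).degree < d :=
  (degree_lt_iff_coeff_zero _ _).2 fun _ h => coeff_columnPoly_of_le M j h

/-- Since message matrices are symmetric, the content of a node is given by the values of the
column polynomials at its evaluation point. -/
theorem eval_columnPoly {r : ℕ} {M : Matrix (Fin d) (Fin d) F} (hM : M ∈ pmMessage F r d)
    (j : Fin d) (z : F) : (columnPoly M j).eval z = Matrix.vecMul (psi d z) M j := by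
  simp only [columnPoly, eval_finsetSum, eval_mul, eval_C, eval_pow, eval_X, Matrix.vecMul,
    dotProduct, psi]
  exact Finset.sum_congr rfl fun t _ => by rw [hM.1.apply, mul_comm]

theorem columnPoly_sum {ι : Type*} (s : Finset ι) (M : ι → Matrix (Fin d) (Fin d) F) (j : Fin d) :
    columnPoly (∑ i ∈ s, M i) j = ∑ i ∈ s, columnPoly (M i) j := by
  simp only [columnPoly, Matrix.sum_apply, map_sum, Finset.sum_mul]
  exact Finset.sum_comm

/-- The polynomial `∑ u ≤ a, X^(u nl) m_u(X)`, where `m_u` is the column polynomial of column `j`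
of `N u`. -/
noncomputable def blockPoly (nl a : ℕ) (N : ℕ → Matrix (Fin d) (Fin d) F) (j : Fin d) : F[X] :=
  ∑ u ∈ Finset.range (a + 1), X ^ (nl * u) * columnPoly (N u) j

/-- As `d ≤ nl`, the blocks of `blockPoly` do not overlap. -/
theorem coeff_blockPoly {nl a u s : ℕ} (N : ℕ → Matrix (Fin d) (Fin d) F) (j : Fin d)
    (hd : d ≤ nl) (hs : s < nl) (hu : u ≤ a) :
    (blockPoly nl a N j).coeff (nl * u + s) = (columnPoly (N u) j).coeff s := by
  rw [blockPoly, finsetSum_coeff, Finset.sum_eq_single_of_mem u (by simpa using by omega)]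
  · rw [coeff_X_pow_mul', if_pos (by omega), Nat.add_sub_cancel_left]
  · intro v _ hv
    rw [coeff_X_pow_mul']
    split_ifs with h
    · refine coeff_columnPoly_of_le _ _ (hd.trans ?_)
      have : v < u := by
        refine lt_of_le_of_ne (Nat.le_of_lt_succ ?_) hv
        by_contra! h'
        have := Nat.mul_le_mul_left nl h'
        rw [Nat.mul_succ] at this
        omega
      have := Nat.mul_le_mul_left nl (Nat.succ_le_of_lt this)
      rw [Nat.mul_succ] at this
      omega
    · rfl

theorem degree_blockPoly_lt {nl a p : ℕ} {N : ℕ → Matrix (Fin d) (Fin d) F} {j : Fin d}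
    (hd : d ≤ nl) (h : ∀ t : Fin d, p ≤ t → N a j t = 0) :
    (blockPoly nl a N j).degree < (a * nl + p : ℕ) := by
  rw [degree_lt_iff_coeff_zero]
  intro k hk
  rw [blockPoly, finsetSum_coeff]
  refine Finset.sum_eq_zero fun u hu => ?_
  rw [coeff_X_pow_mul']
  split_ifs with hle
  · rcases (Nat.le_of_lt_succ (Finset.mem_range.1 hu)).eq_or_lt with rfl | hlt
    · rcases lt_or_ge (k - nl * u) d with hkd | hkd
      · rw [mul_comm] at hk
        exact (coeff_columnPoly (N u) j ⟨_, hkd⟩).trans (h ⟨_, hkd⟩ (by simp only; omega))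
      · exact coeff_columnPoly_of_le _ _ hkd
    · refine coeff_columnPoly_of_le _ _ (hd.trans ?_)
      have := Nat.mul_le_mul_left nl (Nat.succ_le_of_lt hlt)
      rw [Nat.mul_succ, mul_comm nl a] at this
      omega
  · rfl

theorem eval_blockPoly {nl a : ℕ} (N : ℕ → Matrix (Fin d) (Fin d) F) (j : Fin d) (z : F) :
    (blockPoly nl a N j).eval z =
      (columnPoly (∑ u ∈ Finset.range (a + 1), (z ^ nl) ^ u • N u) j).eval z := by
  rw [columnPoly_sum, blockPoly, eval_finsetSum, eval_finsetSum]
  refine Finset.sum_congr rfl fun u _ => ?_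
  simp [columnPoly, eval_finsetSum, Finset.mul_sum, pow_mul, mul_assoc]

/-- The heart of the distance and reconstruction properties. The columns `j ≥ p` give polynomials
of degree below `a nl + p`, which vanish; by symmetry the remaining columns then satisfy the same
degree bound, and vanish as well. -/
theorem eq_zero_of_eval_blockPoly {nl a p : ℕ} {N : ℕ → Matrix (Fin d) (Fin d) F}
    (hd : d ≤ nl) (hNa : N a ∈ pmMessage F p d)
    {Z : Finset F} (hZ : a * nl + p ≤ Z.card)
    (h : ∀ z ∈ Z, ∀ j, (blockPoly nl a N j).eval z = 0) : ∀ u ≤ a, N u = 0 := by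
  have key : ∀ j : Fin d, (∀ t : Fin d, p ≤ t → N a j t = 0) → ∀ u ≤ a, ∀ t, N u j t = 0 := by
    intro j hj u hu t
    have h0 : blockPoly nl a N j = 0 :=
      eq_zero_of_degree_lt_of_eval_finset_eq_zero Z
        ((degree_blockPoly_lt hd hj).trans_le (by exact_mod_cast hZ)) fun z hz => h z hz j
    rw [← coeff_columnPoly (N u) j t, ← coeff_blockPoly N j hd (t.2.trans_le hd) hu, h0, coeff_zero]
  have key1 : ∀ j : Fin d, p ≤ j → ∀ u ≤ a, ∀ t, N u j t = 0 := fun j hj =>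
    key j fun t ht => hNa.2 j t hj ht
  intro u hu
  ext j t
  refine key j (fun t ht => ?_) u hu t
  rw [← hNa.1.apply]
  exact key1 t ht a le_rfl j

end Messages

/-! ### The common encoder -/

section Encoder

variable {F ι : Type*} [Field F]

/-- The matrices `A 0, …, A (a - 1), B` as a sequence, constant from index `a` on. -/
def blockSeq {R : Type*} {a : ℕ} (A : Fin a → R) (B : R) (u : ℕ) : R :=
  if h : u < a then A ⟨u, h⟩ else B

/-- The encoder behind both the product-matrix code (`a = 0`, `p = r`) and the lifted code: in
stripe `l`, coordinate `j`, node `i` stores the value at `x i` of the block polynomial of column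
`j`. The coefficient matrices of the blocks `u < a` are message matrices for the parameter `r`,
and that of the block `a` is one for the parameter `p`. -/
noncomputable def blockEncoder (nl a r p d β : ℕ) (x : ι → F) :
    (Fin β → (Fin a → pmMessage F r d) × pmMessage F p d) →ₗ[F] (ι → Fin β × Fin d → F) where
  toFun N i q := (blockPoly nl a
    (blockSeq (fun u => ((N q.1).1 u : Matrix (Fin d) (Fin d) F)) (N q.1).2) q.2).eval (x i)
  map_add' N N' := by
    ext i q
    simp only [Pi.add_apply, blockPoly, eval_finsetSum, ← Finset.sum_add_distrib]
    refine Finset.sum_congr rfl fun u _ => ?_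
    unfold blockSeq
    split_ifs <;> simp [columnPoly, eval_finsetSum, add_mul, Finset.sum_add_distrib, mul_add]
  map_smul' s N := by
    ext i q
    simp only [Pi.smul_apply, blockPoly, eval_finsetSum, Finset.smul_sum, RingHom.id_apply]
    refine Finset.sum_congr rfl fun u _ => ?_
    unfold blockSeq
    split_ifs <;> simp [columnPoly, eval_finsetSum, Finset.mul_sum, mul_left_comm, mul_assoc]

variable {nl a r p d β : ℕ} {x : ι → F}

theorem mem_range_blockEncoder {c : ι → Fin β × Fin d → F} :
    c ∈ LinearMap.range (blockEncoder nl a r p d β x) ↔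
      ∃ N : Fin β → ℕ → Matrix (Fin d) (Fin d) F, (∀ l, ∀ u < a, N l u ∈ pmMessage F r d) ∧
        (∀ l, N l a ∈ pmMessage F p d) ∧
        ∀ i l j, c i (l, j) = (blockPoly nl a (N l) j).eval (x i) := by
  constructor
  · rintro ⟨N, rfl⟩
    refine ⟨fun l => blockSeq (fun u => ((N l).1 u : Matrix (Fin d) (Fin d) F)) (N l).2,
      fun l u hu => ?_, fun l => ?_, fun i l j => rfl⟩
    · simp [blockSeq, hu]
    · simp [blockSeq]
  · rintro ⟨N, h1, h2, h3⟩
    refine ⟨fun l => (fun u => ⟨N l u, h1 l u u.2⟩, ⟨N l a, h2 l⟩), ?_⟩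
    ext i ⟨l, j⟩
    rw [h3]
    change (blockPoly _ _ _ _).eval _ = _
    congr 1
    refine Finset.sum_congr rfl fun u hu => ?_
    rw [Finset.mem_range] at hu
    simp only [blockSeq]
    split_ifs with h
    · rfl
    · rw [show u = a by omega]

/-- Any `a nl + p` nodes determine the message. -/
theorem blockEncoder_eq_zero (hx : Function.Injective x) (hd : d ≤ nl) {S : Finset ι}
    (hS : a * nl + p ≤ S.card) {N : Fin β → (Fin a → pmMessage F r d) × pmMessage F p d}
    (h : ∀ i ∈ S, blockEncoder nl a r p d β x N i = 0) : N = 0 := by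
  classical
  have key : ∀ l, ∀ u ≤ a, blockSeq (fun u => ((N l).1 u : Matrix (Fin d) (Fin d) F)) (N l).2 u
      = 0 := fun l => by
    refine eq_zero_of_eval_blockPoly (p := p) (nl := nl) (Z := S.image x) hd ?_ ?_ ?_
    · simp [blockSeq]
    · rwa [Finset.card_image_of_injective _ hx]
    · intro z hz j
      obtain ⟨i, hi, rfl⟩ := Finset.mem_image.1 hz
      exact congrFun (h i hi) (l, j)
  funext l
  refine Prod.ext (funext fun u => Subtype.ext ?_) (Subtype.ext ?_)
  · simpa [blockSeq] using key l u u.2.le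
  · simpa [blockSeq] using key l a le_rfl

theorem range_blockEncoder_reconstruct (hx : Function.Injective x) (hd : d ≤ nl) (S : Finset ι)
    (hS : S.card = a * nl + p) :
    ∀ c ∈ LinearMap.range (blockEncoder nl a r p d β x),
      ∀ c' ∈ LinearMap.range (blockEncoder nl a r p d β x), (∀ i ∈ S, c i = c' i) → c = c' := by
  rintro _ ⟨N, rfl⟩ _ ⟨N', rfl⟩ h
  rw [← sub_eq_zero, ← map_sub, blockEncoder_eq_zero hx hd hS.ge (N := N - N') fun i hi => ?_,
    map_zero]
  rw [map_sub, Pi.sub_apply, h i hi, sub_self]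

theorem finrank_range_blockEncoder [Fintype ι] (hx : Function.Injective x) (hd : d ≤ nl)
    (hr : r ≤ d) (hp : p ≤ d) (hι : a * nl + p ≤ Fintype.card ι) :
    Module.finrank F (LinearMap.range (blockEncoder nl a r p d β x)) =
      a * mbrSize r d β + mbrSize p d β := by
  rw [LinearMap.finrank_range_of_inj]
  · rw [Module.finrank_pi_fintype]
    simp only [Module.finrank_prod, Module.finrank_pi_fintype, finrank_pmMessage hr,
      finrank_pmMessage hp, Finset.sum_const, Finset.card_univ, Fintype.card_fin, smul_eq_mul,
      mbrSize]
    ring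
  · rw [injective_iff_map_eq_zero]
    intro N hN
    exact blockEncoder_eq_zero hx hd (S := Finset.univ) hι fun i _ => by rw [hN]; rfl

end Encoder

/-! ### The product-matrix code is an MBR code -/

section ProductMatrix

variable {F ι : Type*} [Field F] {r d β : ℕ} {x : ι → F}

theorem pmMBRCode_eq_range (nl : ℕ) :
    pmMBRCode r d β x = LinearMap.range (blockEncoder nl 0 r r d β x) := by
  ext c
  rw [mem_range_blockEncoder]
  constructor
  · rintro ⟨M, hM, hc⟩
    refine ⟨fun l _ => M l, fun l u hu => absurd hu (Nat.not_lt_zero u), hM, fun i l j => ?_⟩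
    simpa [eval_blockPoly, eval_columnPoly (hM l)] using hc i l j
  · rintro ⟨N, -, hN, hc⟩
    refine ⟨fun l => N l 0, hN, fun i l j => ?_⟩
    simpa [eval_blockPoly, eval_columnPoly (hN l)] using hc i l j

/-- A helper node sends the inner products of the rows it stores with `ψ(x f)`. By symmetry of `M`
these are the values at the `d` helpers of the polynomial with coefficient vector `ψ(x f) M`. -/
theorem pmMBRCode_repair (hx : Function.Injective x) (f : ι) (D : Finset ι) (hD : D.card = d) :
    ∃ (download : D → (Fin β × Fin d → F) →ₗ[F] (Fin β → F))
      (recover : (D → Fin β → F) →ₗ[F] (Fin β × Fin d → F)),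
      ∀ c ∈ pmMBRCode r d β x, c f = recover (fun i => download i (c i)) := by
  classical
  let T : (Fin d → F) →ₗ[F] (D → F) := Matrix.mulVecLin (Matrix.of fun i : D => psi d (x i))
  have hT : LinearMap.ker T = ⊥ := by
    rw [LinearMap.ker_eq_bot']
    intro w hw
    funext t
    have h0 : columnPoly (Matrix.of fun _ => w) t = 0 := by
      refine eq_zero_of_degree_lt_of_eval_finset_eq_zero (D.image x) ?_ fun z hz => ?_
      · rw [Finset.card_image_of_injective _ hx, hD]
        exact degree_columnPoly_lt _ t
      · obtain ⟨i, hi, rfl⟩ := Finset.mem_image.1 hz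
        have := congrFun hw ⟨i, hi⟩
        simp only [columnPoly, eval_finsetSum, eval_mul, eval_C, eval_pow, eval_X, Matrix.of_apply]
        exact (Finset.sum_congr rfl fun k _ => mul_comm _ _).trans this
    simpa [h0] using (coeff_columnPoly (Matrix.of fun _ => w) t t).symm
  obtain ⟨L, hL⟩ := T.exists_leftInverse_of_injective hT
  refine ⟨fun _ => LinearMap.pi fun l =>
      ∑ j, (psi d (x f) j) • LinearMap.proj (l, j),
    LinearMap.pi fun q => LinearMap.proj q.2 ∘ₗ L ∘ₗ LinearMap.pi fun i =>
      LinearMap.proj q.1 ∘ₗ LinearMap.proj i, ?_⟩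
  rintro c ⟨M, hM, hc⟩
  ext ⟨l, j⟩
  have h1 : (fun i : D => ∑ j, psi d (x f) j * c i (l, j)) =
      T (Matrix.vecMul (psi d (x f)) (M l)) := by
    funext i
    have h2 : Matrix.vecMul (psi d (x f)) (M l) = Matrix.mulVec (M l) (psi d (x f)) := by
      rw [← Matrix.mulVec_transpose, (hM l).1.eq]
    rw [h2]
    change _ = psi d (x i) ⬝ᵥ _
    rw [Matrix.dotProduct_mulVec, dotProduct]
    exact Finset.sum_congr rfl fun j _ => by rw [hc, mul_comm]
  have h3 := congrArg (fun w => L w j) h1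
  have h4 : L (T (Matrix.vecMul (psi d (x f)) (M l))) = Matrix.vecMul (psi d (x f)) (M l) :=
    LinearMap.congr_fun hL _
  rw [h4] at h3
  rw [hc, ← h3]
  change L _ j = L _ j
  refine congrArg (fun w => L w j) (funext fun i => ?_)
  simp

theorem pmMBRCode_isMBR [Fintype ι] (hx : Function.Injective x) (hrd : r ≤ d) (hd : 1 ≤ d)
    (hrι : r ≤ Fintype.card ι) :
    (pmMBRCode r d β x).IsMBR (Fintype.card ι) r d (d * β) β (mbrSize r d β) where
  card_nodes := rfl
  card_symbol := by simp [mul_comm]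
  beta_le := Nat.le_mul_of_pos_left β hd
  file_size := by
    rw [pmMBRCode_eq_range d,
      finrank_range_blockEncoder hx le_rfl hrd hrd (by simpa using hrι), zero_mul, zero_add]
  reconstruct S hS := by
    rw [pmMBRCode_eq_range d]
    exact range_blockEncoder_reconstruct hx le_rfl S (by simpa using hS)
  repair f D _ hD := pmMBRCode_repair hx f D hD
  alpha_eq := rfl
  size_eq := rfl

end ProductMatrix

/-! ### Local groups that are fibres of the power map -/

section Groups

variable {n nl : ℕ}

theorem mem_localGroup {i : Fin (n / nl)} {t : Fin n} :
    t ∈ localGroup n nl i ↔ (t : ℕ) % (n / nl) = i := by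
  simp [localGroup]

theorem localGroup_disjoint {i j : Fin (n / nl)} (h : i ≠ j) :
    Disjoint (localGroup n nl i) (localGroup n nl j) :=
  Finset.disjoint_left.2 fun _ hi hj =>
    h (Fin.ext ((mem_localGroup.1 hi).symm.trans (mem_localGroup.1 hj)))

theorem exists_mem_localGroup (hn : nl ∣ n) (t : Fin n) : ∃ i, t ∈ localGroup n nl i := by
  have h := t.pos
  have : 0 < n / nl := Nat.div_pos (Nat.le_of_dvd h hn) (Nat.pos_of_dvd_of_pos hn h)
  exact ⟨⟨_, Nat.mod_lt t this⟩, mem_localGroup.2 rfl⟩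

theorem card_localGroup (hn : nl ∣ n) (i : Fin (n / nl)) : (localGroup n nl i).card = nl := by
  obtain ⟨ν, rfl⟩ := hn
  have hnl : 0 < nl := by
    rcases Nat.eq_zero_or_pos nl with rfl | h
    · simpa using i.pos
    · exact h
  have hν : nl * ν / nl = ν := Nat.mul_div_cancel_left ν hnl
  have hi : (i : ℕ) < ν := i.2.trans_eq hν
  have key : ∀ k < nl, (i : ℕ) + ν * k < nl * ν := fun k hk => by
    have := Nat.mul_le_mul_left ν (Nat.succ_le_of_lt hk)
    rw [Nat.mul_succ, mul_comm ν nl] at this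
    omega
  refine (Finset.card_nbij' (s := localGroup (nl * ν) nl i) (t := Finset.range nl)
    (fun t => (t : ℕ) / ν)
    (fun k => if h : (i : ℕ) + ν * k < nl * ν then ⟨_, h⟩ else ⟨0, i.pos.trans_le (Nat.div_le_self _ _)⟩)
    ?_ ?_ ?_ ?_).trans (Finset.card_range nl)
  · intro t _
    simpa using Nat.div_lt_of_lt_mul (by rw [mul_comm ν]; exact t.2)
  · intro k hk
    have hk' : k < nl := by simpa using hk
    simp [key k hk', mem_localGroup, hν, Nat.mod_eq_of_lt hi]
  · intro t ht
    have ht' : (t : ℕ) % ν = i := by simpa [mem_localGroup, hν] using ht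
    have : (i : ℕ) + ν * (t / ν) = t := by rw [← ht', Nat.mod_add_div]
    simp [this]
  · intro k hk
    have hk' : k < nl := by simpa using hk
    simp [key k hk', Nat.add_mul_div_left _ _ (i.pos.trans_eq hν), Nat.div_eq_of_lt hi]

variable {F : Type*} [Field F] {x : Fin n → F}

theorem monic_annihilator (i : Fin (n / nl)) : (annihilator n nl x i).Monic :=
  monic_prod_of_monic _ _ fun t _ => monic_X_sub_C (x t)

theorem degree_annihilator (hn : nl ∣ n) (i : Fin (n / nl)) :
    (annihilator n nl x i).degree = nl := by
  rw [annihilator, degree_prod]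
  simp [card_localGroup hn]

theorem isRoot_annihilator {i : Fin (n / nl)} {t : Fin n} (ht : t ∈ localGroup n nl i) :
    (annihilator n nl x i).IsRoot (x t) := by
  rw [IsRoot, annihilator, eval_prod]
  exact Finset.prod_eq_zero ht (by simp)

theorem IsLift.eval_eq {m : Fin (n / nl) → F[X]} {G : F[X]} (h : IsLift n nl x m G)
    {i : Fin (n / nl)} {t : Fin n} (ht : t ∈ localGroup n nl i) :
    G.eval (x t) = (m i).eval (x t) := by
  rw [← h.2 i]
  exact (eval₂_modByMonic_eq_self_of_root (f := RingHom.id F) (isRoot_annihilator ht)).symm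

/-- Polynomials of degree below `nl` are determined by their values on a local group. -/
theorem eq_of_eval_localGroup (hx : Function.Injective x) (hn : nl ∣ n) {i : Fin (n / nl)}
    {f g : F[X]} (hf : f.degree < nl) (hg : g.degree < nl)
    (h : ∀ t ∈ localGroup n nl i, f.eval (x t) = g.eval (x t)) : f = g := by
  classical
  refine eq_of_degrees_lt_of_eval_finset_eq ((localGroup n nl i).image x) ?_ ?_ fun z hz => ?_
  · rwa [Finset.card_image_of_injective _ hx, card_localGroup hn]
  · rwa [Finset.card_image_of_injective _ hx, card_localGroup hn]
  · obtain ⟨t, ht, rfl⟩ := Finset.mem_image.1 hz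
    exact h t ht

theorem isLift_of_eval_eq (hx : Function.Injective x) (hn : nl ∣ n) {m : Fin (n / nl) → F[X]}
    {G : F[X]} (hG : G.degree < n) (hm : ∀ i, (m i).degree < nl)
    (h : ∀ i, ∀ t ∈ localGroup n nl i, G.eval (x t) = (m i).eval (x t)) : IsLift n nl x m G := by
  refine ⟨hG, fun i => eq_of_eval_localGroup hx hn (i := i) ?_ (hm i) fun t ht => ?_⟩
  · rw [← degree_annihilator (x := x) hn i]
    exact degree_modByMonic_lt _ (monic_annihilator i)
  · rw [← h i t ht]
    exact eval₂_modByMonic_eq_self_of_root (f := RingHom.id F) (isRoot_annihilator ht)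

theorem sum_range_mul_eq {A : Type*} [AddCommMonoid A] (ν nl : ℕ) (f : ℕ → A) :
    ∑ k ∈ Finset.range (nl * ν), f k =
      ∑ u ∈ Finset.range ν, ∑ s ∈ Finset.range nl, f (nl * u + s) := by
  induction ν with
  | zero => simp
  | succ ν ih => rw [Nat.mul_succ, Finset.sum_range_add, ih, Finset.sum_range_succ]

/-- If `X^nl` takes the constant value `y i` on group `i`, reduction modulo `f^(i)` is the
substitution `X^(nl u + s) ↦ (y i)^u X^s`. -/
theorem IsLift.coeff_eq (hx : Function.Injective x) (hn : nl ∣ n) {m : Fin (n / nl) → F[X]}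
    {G : F[X]} (h : IsLift n nl x m G) {i : Fin (n / nl)} {y : F}
    (hy : ∀ t ∈ localGroup n nl i, x t ^ nl = y) (hm : (m i).degree < nl) {s : ℕ} (hs : s < nl) :
    (m i).coeff s = ∑ u ∈ Finset.range (n / nl), G.coeff (nl * u + s) * y ^ u := by
  have hc : ∀ s, (∑ k ∈ Finset.range nl, C (∑ u ∈ Finset.range (n / nl),
      G.coeff (nl * u + k) * y ^ u) * X ^ k : F[X]).coeff s =
      if s < nl then ∑ u ∈ Finset.range (n / nl), G.coeff (nl * u + s) * y ^ u else 0 := by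
    intro s
    simp only [finsetSum_coeff, coeff_C_mul_X_pow]
    rw [Finset.sum_ite_eq]
    simp
  have hG : G.natDegree < n := by
    by_cases h0 : G = 0
    · rw [h0, natDegree_zero]
      exact i.pos.trans_le (Nat.div_le_self n nl)
    · exact (natDegree_lt_iff_degree_lt h0).2 h.1
  rw [eq_of_eval_localGroup hx hn (i := i) hm (g := ∑ k ∈ Finset.range nl,
    C (∑ u ∈ Finset.range (n / nl), G.coeff (nl * u + k) * y ^ u) * X ^ k), hc, if_pos hs]
  · refine (degree_lt_iff_coeff_zero _ _).2 fun k hk => ?_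
    rw [hc, if_neg (by omega)]
  · intro t ht
    rw [← h.eval_eq ht, eval_eq_sum_range' (hG.trans_eq (Nat.mul_div_cancel' hn).symm),
      sum_range_mul_eq, Finset.sum_comm, eval_finsetSum]
    refine Finset.sum_congr rfl fun k _ => ?_
    rw [eval_mul, eval_C, eval_pow, eval_X, Finset.sum_mul]
    refine Finset.sum_congr rfl fun u _ => ?_
    rw [pow_add, pow_mul, hy t ht, mul_assoc]

end Groups

/-! ### The lifted code -/

section Lifted

variable {F : Type*} [Field F] {n nl r d β K : ℕ} {x : Fin n → F} {y : Fin (n / nl) → F}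

theorem coeff_eq_of_sum_mul_pow_eq {ν : ℕ} {y : Fin ν → F} (hy : Function.Injective y)
    {c c' : ℕ → F} (h : ∀ i, ∑ u ∈ Finset.range ν, c u * y i ^ u =
      ∑ u ∈ Finset.range ν, c' u * y i ^ u) {u : ℕ} (hu : u < ν) : c u = c' u := by
  have := Matrix.eq_zero_of_forall_index_sum_mul_pow_eq_zero (v := fun u : Fin ν => c u - c' u)
    hy fun i => by
      have hi := h i
      rw [Finset.sum_range, Finset.sum_range] at hi
      simp only [sub_mul, Finset.sum_sub_distrib, hi, sub_self]
  exact sub_eq_zero.1 (congrFun this ⟨u, hu⟩)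

theorem add_le_of_lt_div {a : ℕ} (hn : nl ∣ n) (ha : a < n / nl) (hd : d ≤ nl) :
    a * nl + d ≤ n := by
  have := Nat.mul_le_mul_right nl (Nat.succ_le_of_lt ha)
  rw [Nat.div_mul_cancel hn, Nat.succ_mul] at this
  omega

/-- Words of the encoder satisfy the degree caps. -/
theorem range_blockEncoder_le {p : ℕ} (hx : Function.Injective x) (hn : nl ∣ n)
    (hxy : ∀ i, ∀ t ∈ localGroup n nl i, x t ^ nl = y i) (hpr : p ≤ r) (hd : d < nl)
    (ha : liftQuot r d β K < n / nl) (hp : leadingSumInv nl r d β (liftRem r d β K) = p) :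
    LinearMap.range (blockEncoder nl (liftQuot r d β K) r p d β x) ≤
      liftedMBRCode n nl r d β K x := by
  intro c hc
  obtain ⟨N, hN, hNa, hc⟩ := mem_range_blockEncoder.1 hc
  set a := liftQuot r d β K with ha'
  have hM : ∀ l i, ∑ u ∈ Finset.range (a + 1), y i ^ u • N l u ∈ pmMessage F r d := by
    refine fun l i => Submodule.sum_mem _ fun u hu => Submodule.smul_mem _ _ ?_
    rcases (Nat.le_of_lt_succ (Finset.mem_range.1 hu)).eq_or_lt with rfl | h
    · exact pmMessage_mono hpr (hNa l)
    · exact hN l u h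
  have hlt : ∀ l j, (blockPoly nl a (N l) j).degree < (a * nl + d : ℕ) := fun l j =>
    degree_blockPoly_lt hd.le fun t ht => absurd ht (not_le.2 t.2)
  refine ⟨fun l i => ∑ u ∈ Finset.range (a + 1), y i ^ u • N l u, hM, fun l j =>
    ⟨blockPoly nl a (N l) j, isLift_of_eval_eq hx hn ?_ (fun i => ?_) fun i t ht => ?_, ?_⟩,
    fun i t ht l j => ?_⟩
  · exact (hlt l j).trans_le (by exact_mod_cast add_le_of_lt_div hn ha hd.le)
  · exact (degree_columnPoly_lt _ j).trans (by exact_mod_cast hd)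
  · rw [eval_blockPoly, hxy i t ht]
  · rw [degreeCap, hp, ← ha']
    split_ifs with hj
    · exact hlt l j
    · exact degree_blockPoly_lt hd.le fun t ht => (hNa l).2 j t (not_lt.1 hj) ht
  · rw [hc, eval_blockPoly, hxy i t ht]
    exact eval_columnPoly (hM l i) j (x t)

/-- Conversely, the coefficients of the lifted polynomials form the message of the encoder. They
are determined by the `n / nl` local message matrices, so that they inherit the symmetry and the
vanishing block, and the degree caps say that the matrix of the leading coefficients is a message
matrix for the parameter `p`. -/
theorem liftedMBRCode_le_range {p : ℕ} (hx : Function.Injective x) (hy : Function.Injective y)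
    (hn : nl ∣ n) (hxy : ∀ i, ∀ t ∈ localGroup n nl i, x t ^ nl = y i) (hpr : p ≤ r) (hrd : r ≤ d)
    (hd : d < nl) (ha : liftQuot r d β K < n / nl)
    (hp : leadingSumInv nl r d β (liftRem r d β K) = p) :
    liftedMBRCode n nl r d β K x ≤
      LinearMap.range (blockEncoder nl (liftQuot r d β K) r p d β x) := by
  rintro c ⟨M, hM, hG, hc⟩
  rw [mem_range_blockEncoder]
  choose G hlift hcap using hG
  have hcoeff : ∀ l i (j t : Fin d),
      M l i j t = ∑ u ∈ Finset.range (n / nl), (G l j).coeff (nl * u + t) * y i ^ u := by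
    intro l i j t
    rw [← coeff_columnPoly (M l i) j t]
    exact (hlift l j).coeff_eq (m := fun i => columnPoly (M l i) j) hx hn (hxy i)
      ((degree_columnPoly_lt _ j).trans (by exact_mod_cast hd)) (t.2.trans hd)
  have hsymm : ∀ l (j t : Fin d), ∀ u < n / nl,
      (G l t).coeff (nl * u + j) = (G l j).coeff (nl * u + t) := fun l j t u hu =>
    coeff_eq_of_sum_mul_pow_eq (c := fun u => (G l t).coeff (nl * u + j))
      (c' := fun u => (G l j).coeff (nl * u + t)) hy
      (fun i => by rw [← hcoeff, ← hcoeff]; exact (hM l i).1.apply j t) hu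
  have hblock : ∀ l (j t : Fin d), r ≤ j → r ≤ t → ∀ u < n / nl,
      (G l j).coeff (nl * u + t) = 0 := fun l j t hj ht u hu =>
    coeff_eq_of_sum_mul_pow_eq (c := fun u => (G l j).coeff (nl * u + t)) (c' := fun _ => 0) hy
      (fun i => by rw [← hcoeff, (hM l i).2 j t hj ht]; simp) hu
  set a := liftQuot r d β K with ha'
  have hhigh : ∀ l (j t : Fin d) u, a < u → (G l j).coeff (nl * u + t) = 0 := by
    intro l j t u hu
    refine (degree_lt_iff_coeff_zero _ _).1 (hcap l j) _ ?_
    have := Nat.mul_le_mul_right nl (Nat.succ_le_of_lt hu)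
    rw [Nat.succ_mul, mul_comm u] at this
    rw [degreeCap, hp, ← ha']
    split_ifs <;> omega
  refine ⟨fun l u => Matrix.of fun j t : Fin d => (G l j).coeff (nl * u + t), fun l u hu => ?_,
    fun l => ?_, fun t l j => ?_⟩
  · exact ⟨Matrix.IsSymm.ext fun j t => hsymm l j t u (hu.trans ha),
      fun j t hj ht => hblock l j t hj ht u (hu.trans ha)⟩
  · refine ⟨Matrix.IsSymm.ext fun j t => hsymm l j t a ha, fun j t hj ht => ?_⟩
    refine (degree_lt_iff_coeff_zero _ _).1 (hcap l j) _ ?_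
    rw [degreeCap, hp, if_neg (not_lt.2 hj), ← ha', mul_comm]
    omega
  · obtain ⟨i, hi⟩ := exists_mem_localGroup hn t
    rw [hc i t hi, eval_blockPoly, hxy i t hi, ← eval_columnPoly (hM l i)]
    congr 2
    ext j k
    rw [hcoeff, Matrix.sum_apply]
    simp only [Matrix.smul_apply, Matrix.of_apply, smul_eq_mul]
    rw [← Finset.sum_subset (s₁ := Finset.range (a + 1))]
    · exact Finset.sum_congr rfl fun u _ => mul_comm _ _
    · simpa using ha
    · intro u _ hu
      rw [hhigh l j k u (by simpa using hu), zero_mul]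

theorem eval_blockPoly_vecMulVec (a nl : ℕ) (h v : F[X]) (hh : h.natDegree ≤ a)
    (hv : v.natDegree < d) (j : Fin d) (z : F) :
    (blockPoly nl a (fun u => h.coeff u •
      Matrix.vecMulVec (fun i : Fin d => v.coeff i) fun i : Fin d => v.coeff i) j).eval z =
      h.eval (z ^ nl) * (v.coeff j * v.eval z) := by
  rw [eval_eq_sum_range' (Nat.lt_succ_of_le hh), eval_eq_sum_range' hv, blockPoly, eval_finsetSum,
    Finset.sum_mul]
  refine Finset.sum_congr rfl fun u _ => ?_
  rw [Finset.sum_range]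
  simp only [columnPoly, Matrix.smul_apply, Matrix.vecMulVec_apply, eval_mul, eval_pow, eval_X,
    eval_finsetSum, eval_C, Finset.mul_sum, smul_eq_mul, pow_mul]
  exact Finset.sum_congr rfl fun k _ => by ring

/-- The codeword of minimum weight: all coefficient matrices are multiples of a rank one matrix
`v vᵀ`. The polynomial `v` vanishes on `p - 1` nodes of group `a`, and the scalar factor, a
polynomial in `X^nl`, on the groups `0, …, a - 1`. -/
theorem exists_mem_range_blockEncoder {a p : ℕ} (hx : Function.Injective x) (hn : nl ∣ n)
    (hxy : ∀ i, ∀ t ∈ localGroup n nl i, x t ^ nl = y i) (hβ : 1 ≤ β) (hp : 1 ≤ p) (hpr : p ≤ r)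
    (hrd : r ≤ d) (hd : d < nl) (ha : a < n / nl) :
    ∃ c ∈ LinearMap.range (blockEncoder nl a r p d β x), c ≠ 0 ∧
      ∃ Z : Finset (Fin n), Z.card + 1 = a * nl + p ∧ ∀ t ∈ Z, c t = 0 := by
  classical
  obtain ⟨T, hTS, hT⟩ := Finset.exists_subset_card_eq (s := localGroup n nl ⟨a, ha⟩) (n := p - 1)
    (by rw [card_localGroup hn]; omega)
  let h : F[X] := ∏ i : Fin a, (X - C (y (Fin.castLE ha.le i)))
  let v : F[X] := ∏ t ∈ T, (X - C (x t))
  have hhm : h.Monic := monic_prod_of_monic _ _ fun _ _ => monic_X_sub_C _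
  have hvm : v.Monic := monic_prod_of_monic _ _ fun _ _ => monic_X_sub_C _
  have hh : h.natDegree = a := by
    rw [natDegree_prod_of_monic _ _ fun _ _ => monic_X_sub_C _]; simp
  have hv : v.natDegree = p - 1 := by
    rw [natDegree_prod_of_monic _ _ fun _ _ => monic_X_sub_C _]; simp [hT]
  let N : ℕ → Matrix (Fin d) (Fin d) F := fun u => h.coeff u •
      Matrix.vecMulVec (fun i : Fin d => v.coeff i) fun i : Fin d => v.coeff i
  have hN : ∀ u, N u ∈ pmMessage F p d := fun u => by
    refine Submodule.smul_mem _ _ ⟨Matrix.IsSymm.ext fun i j => ?_, fun i j hi hj => ?_⟩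
    · simp [Matrix.vecMulVec_apply, mul_comm]
    · rw [Matrix.vecMulVec_apply, coeff_eq_zero_of_natDegree_lt (by omega), zero_mul]
  have heval : ∀ j z, (blockPoly nl a N j).eval z =
      h.eval (z ^ nl) * (v.coeff j * v.eval z) := fun j z =>
    eval_blockPoly_vecMulVec a nl h v hh.le (by omega) j z
  refine ⟨fun t q => (blockPoly nl a N q.2).eval (x t), mem_range_blockEncoder.2
    ⟨fun _ => N, fun _ u _ => pmMessage_mono hpr (hN u), fun _ => hN a, fun _ _ _ => rfl⟩, ?_,
    Finset.univ.biUnion (fun i : Fin a => localGroup n nl (Fin.castLE ha.le i)) ∪ T, ?_, ?_⟩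
  · intro h0
    have hle := add_le_of_lt_div hn ha (hpr.trans (hrd.trans hd.le))
    have hz := eq_zero_of_eval_blockPoly (N := N) (a := a) hd.le (hN a) (Z := Finset.univ.image x)
      (by rwa [Finset.card_image_of_injective _ hx, Finset.card_univ, Fintype.card_fin])
      (by
        intro z hz j
        obtain ⟨t, -, rfl⟩ := Finset.mem_image.1 hz
        exact congrFun (congrFun h0 t) (⟨0, hβ⟩, j)) a le_rfl
    -- the entry `(p - 1, p - 1)` of the leading matrix is the product of leading coefficients
    have hz' := congrFun (congrFun hz ⟨p - 1, by omega⟩) ⟨p - 1, by omega⟩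
    have e1 : h.coeff a = 1 := by rw [← hh]; exact hhm.coeff_natDegree
    have e2 : v.coeff (p - 1) = 1 := by rw [← hv]; exact hvm.coeff_natDegree
    simp [N, Matrix.vecMulVec_apply, e1, e2] at hz'
  · rw [Finset.card_union_of_disjoint, Finset.card_biUnion]
    · simp only [card_localGroup hn, Finset.sum_const, Finset.card_univ, Fintype.card_fin,
        smul_eq_mul, hT]
      omega
    · intro i _ j _ hij
      exact localGroup_disjoint fun h => hij (Fin.castLE_injective _ h)
    · refine Finset.disjoint_biUnion_left _ _ _ |>.2 fun i _ => ?_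
      refine Finset.disjoint_of_subset_right hTS (localGroup_disjoint fun h => ?_)
      have := congrArg Fin.val h
      simp at this
      omega
  · intro t ht
    ext q
    refine (heval q.2 (x t)).trans ?_
    rcases Finset.mem_union.1 ht with ht | ht
    · obtain ⟨i, -, hi⟩ := Finset.mem_biUnion.1 ht
      have : h.eval (x t ^ nl) = 0 := by
        rw [hxy _ t hi, eval_prod]
        exact Finset.prod_eq_zero (Finset.mem_univ i) (by simp)
      rw [this, zero_mul, Pi.zero_apply]
    · have : v.eval (x t) = 0 := by
        rw [eval_prod]
        exact Finset.prod_eq_zero ht (by simp)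
      rw [this, mul_zero, mul_zero, Pi.zero_apply]

theorem restrict_liftedMBRCode_le (i : Fin (n / nl)) :
    (liftedMBRCode n nl r d β K x).restrict (localGroup n nl i) ≤
      pmMBRCode r d β fun t : localGroup n nl i => x t := by
  rintro _ ⟨c, ⟨M, hM, -, hc⟩, rfl⟩
  exact ⟨fun l => M l i, fun l => hM l i, fun t l j => hc i t t.2 l j⟩

/-- Every local word is the restriction of a codeword whose message is constant in `X^nl`. -/
theorem pmMBRCode_le_restrict {a p : ℕ} (hap : a = 0 → p = r) (i : Fin (n / nl)) :
    (pmMBRCode r d β fun t : localGroup n nl i => x t) ≤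
      VectorCode.restrict (LinearMap.range (blockEncoder nl a r p d β x)) (localGroup n nl i) := by
  rintro c ⟨M, hM, hc⟩
  have hsum : ∀ l, ∀ z : F, ∑ u ∈ Finset.range (a + 1), z ^ u •
      (if u = 0 then M l else 0) = M l := fun l z => by
    rw [Finset.sum_eq_single_of_mem 0 (by simp) fun u _ hu => by simp [hu]]
    simp
  refine ⟨fun t q => (columnPoly (M q.1) q.2).eval (x t), mem_range_blockEncoder.2
    ⟨fun l u => if u = 0 then M l else 0, fun l u _ => ?_, fun l => ?_, fun t l j => ?_⟩, ?_⟩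
  · dsimp only
    split_ifs
    · exact hM l
    · exact zero_mem _
  · dsimp only
    split_ifs with h
    · rw [hap h]; exact hM l
    · exact zero_mem _
  · rw [eval_blockPoly, hsum]
  · ext t ⟨l, j⟩
    rw [hc]
    exact eval_columnPoly (hM l) j _

/-- The lifted code has all claimed properties as soon as the local groups are fibres of
`X ↦ X^nl` on the evaluation points. -/
theorem isOptimalMBRLocalityCode_of_pow_eq (hP : AdmissibleParams n nl r d β K)
    (hx : Function.Injective x) (hy : Function.Injective y)
    (hxy : ∀ i, ∀ t ∈ localGroup n nl i, x t ^ nl = y i) :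
    IsOptimalMBRLocalityCode n nl r d β K x (liftedMBRCode n nl r d β K x) := by
  obtain ⟨p, hp1, hpr, hK, hpb, hpK, ha, hap⟩ := hP.exists_shape
  obtain ⟨hr1, hrd, hd, hn0, hn, hβ, -⟩ := hP
  have hcode : liftedMBRCode n nl r d β K x =
      LinearMap.range (blockEncoder nl (liftQuot r d β K) r p d β x) :=
    le_antisymm (liftedMBRCode_le_range hx hy hn hxy hpr hrd hd ha hpb)
      (range_blockEncoder_le hx hn hxy hpr hd ha hpb)
  have hlocal : ∀ i, (liftedMBRCode n nl r d β K x).restrict (localGroup n nl i) =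
      pmMBRCode r d β fun t : localGroup n nl i => x t := fun i =>
    le_antisymm (restrict_liftedMBRCode_le i) (hcode ▸ pmMBRCode_le_restrict hap i)
  have hcard : ∀ i, Fintype.card (localGroup n nl i) = nl := fun i => by
    rw [Fintype.card_coe, card_localGroup hn]
  have hmbr : ∀ i, (pmMBRCode r d β fun t : localGroup n nl i => x t).IsMBR nl r d (d * β) β
      (mbrSize r d β) := fun i => by
    have := pmMBRCode_isMBR (β := β) (x := fun t : localGroup n nl i => x t)
      (hx.comp Subtype.val_injective) hrd (hr1.trans hrd) (by rw [hcard]; omega)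
    rwa [hcard] at this
  refine ⟨hx, ?_, ?_, ⟨fun i j h => localGroup_disjoint h, exists_mem_localGroup hn,
    card_localGroup hn, fun i w hw => ?_, fun i => by rw [hlocal]; exact hmbr i⟩, hlocal⟩
  · rw [hcode, finrank_range_blockEncoder hx hd.le hrd (hpr.trans hrd), ← hK]
    rw [Fintype.card_fin]
    exact add_le_of_lt_div hn ha (hpr.trans (hrd.trans hd.le))
  · obtain ⟨c, hc, hc0, Z, hZ, hcZ⟩ :=
      exists_mem_range_blockEncoder (β := β) hx hn hxy hβ hp1 hpr hrd hd ha
    rw [hpK, hcode]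
    simpa only [Fintype.card_fin] using VectorCode.hasMinDist_of_reconstruct
      (range_blockEncoder_reconstruct hx hd.le) Z hZ hc hc0 hcZ
  · rw [hlocal] at hw
    have := VectorCode.lt_of_mem_distances (hmbr i).reconstruct hw
    rw [hcard] at this
    omega

end Lifted

/-! ### Evaluation points -/

/-- If `g` has order `m nl` with `m ≥ ν = n / nl`, the cosets `g^i ⟨g^m⟩`, `i < ν`, serve as local
groups. -/
theorem isOptimalMBRLocalityCode_of_isPrimitiveRoot {F : Type*} [Field F] {n nl r d β K m : ℕ}
    (hP : AdmissibleParams n nl r d β K) {g : F} (hg : IsPrimitiveRoot g (m * nl))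
    (hm : n / nl ≤ m) {x : Fin n → F}
    (hx : ∀ t : Fin n, x t = g ^ ((t : ℕ) % (n / nl) + (t : ℕ) / (n / nl) * m)) :
    IsOptimalMBRLocalityCode n nl r d β K x (liftedMBRCode n nl r d β K x) := by
  have hnl : 0 < nl := by have := hP.d_lt_nl; omega
  have hν : 0 < n / nl := Nat.div_pos (Nat.le_of_dvd hP.n_pos hP.nl_dvd_n) hnl
  have hmod : ∀ t : Fin n, (t : ℕ) % (n / nl) < m := fun t => (Nat.mod_lt _ hν).trans_le hm
  have hlt : ∀ t : Fin n, (t : ℕ) % (n / nl) + (t : ℕ) / (n / nl) * m < m * nl := fun t => by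
    have h1 : (t : ℕ) / (n / nl) < nl :=
      Nat.div_lt_of_lt_mul (by rw [Nat.div_mul_cancel hP.nl_dvd_n]; exact t.2)
    have h2 := Nat.mul_le_mul_right m (Nat.succ_le_of_lt h1)
    rw [Nat.succ_mul, mul_comm nl] at h2
    have := hmod t
    omega
  refine isOptimalMBRLocalityCode_of_pow_eq hP (y := fun i => g ^ ((i : ℕ) * nl)) ?_ ?_ ?_
  · intro s t hst
    rw [hx, hx] at hst
    have h := hg.pow_inj (hlt s) (hlt t) hst
    have h1 : (s : ℕ) % (n / nl) = t % (n / nl) := by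
      simpa [Nat.add_mul_mod_self_right, Nat.mod_eq_of_lt (hmod _)] using congrArg (· % m) h
    have h2 : (s : ℕ) / (n / nl) = t / (n / nl) := by
      rw [h1] at h
      exact Nat.eq_of_mul_eq_mul_right (hν.trans_le hm) (Nat.add_left_cancel h)
    ext
    rw [← Nat.mod_add_div s (n / nl), ← Nat.mod_add_div t (n / nl), h1, h2]
  · intro i j hij
    have hl : ∀ i : Fin (n / nl), (i : ℕ) * nl < m * nl := fun i =>
      Nat.mul_lt_mul_of_pos_right (i.2.trans_le hm) hnl
    exact Fin.ext (Nat.eq_of_mul_eq_mul_right hnl (hg.pow_inj (hl i) (hl j) hij))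
  · intro i t ht
    rw [hx, mem_localGroup.1 ht, ← pow_mul, add_mul, mul_assoc, pow_add, mul_comm _ (m * nl),
      pow_mul g (m * nl), hg.pow_eq_one, one_pow, mul_one]

theorem exists_isPrimitiveRoot_of_dvd {F : Type*} [Field F] [Fintype F] {n : ℕ}
    (h : n ∣ Fintype.card F - 1) : ∃ γ : F, IsPrimitiveRoot γ n := by
  classical
  obtain ⟨g, hg⟩ := IsCyclic.exists_generator (α := Fˣ)
  obtain ⟨m, hm⟩ := h
  have h1 : IsPrimitiveRoot g (Fintype.card F - 1) := by
    rw [← Fintype.card_units, ← Nat.card_eq_fintype_card, ← orderOf_eq_card_of_forall_mem_zpowers hg]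
    exact IsPrimitiveRoot.orderOf g
  have h2 : IsPrimitiveRoot (g : F) (Fintype.card F - 1) := IsPrimitiveRoot.coe_units_iff.2 h1
  refine ⟨(g : F) ^ m, h2.pow ?_ (by rw [hm, mul_comm])⟩
  have := Fintype.one_lt_card (α := F)
  omega

/-- For fixed `nl > 0` the field sizes `q ≡ 1` modulo `nl` include all powers of one number `Q`, so
that one of them lies between `n + 1` and `Q n`. -/
theorem exists_field_card_le {nl : ℕ} (hnl : 0 < nl) : ∃ c : ℕ, ∀ n : ℕ, 0 < n →
    ∃ (F : Type) (_ : Field F) (_ : Fintype F), Fintype.card F ≤ c * n ∧ n < Fintype.card F ∧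
      nl ∣ Fintype.card F - 1 := by
  obtain ⟨p, hple, hp⟩ := Nat.exists_infinite_primes (nl + 1)
  have : Fact p.Prime := ⟨hp⟩
  have hφ : 0 < nl.totient := Nat.totient_pos.2 hnl
  have hQ1 : 1 < p ^ nl.totient := Nat.one_lt_pow hφ.ne' hp.one_lt
  have hQ : p ^ nl.totient ≡ 1 [MOD nl] := Nat.ModEq.pow_totient
    ((Nat.Prime.coprime_iff_not_dvd hp).2 fun h => by
      have := Nat.le_of_dvd hnl h
      omega)
  refine ⟨p ^ nl.totient, fun n hn => ?_⟩
  -- for this `m`, `Q ^ m ≤ n < Q ^ (m + 1)`, and `Q ^ (m + 1)` is the field size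
  set m := Nat.log (p ^ nl.totient) n with hm
  have hcard : Nat.card (GaloisField p (nl.totient * (m + 1))) = (p ^ nl.totient) ^ (m + 1) := by
    rw [GaloisField.card p _ (by positivity), pow_mul]
  let _ : Fintype (GaloisField p (nl.totient * (m + 1))) := Fintype.ofFinite _
  refine ⟨GaloisField p (nl.totient * (m + 1)), inferInstance, inferInstance, ?_⟩
  rw [← Nat.card_eq_fintype_card, hcard]
  refine ⟨?_, Nat.lt_pow_succ_log_self hQ1 n, ?_⟩
  · rw [pow_succ, mul_comm]
    exact Nat.mul_le_mul_left _ (Nat.pow_log_le_self _ hn.ne')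
  · refine (Nat.modEq_iff_dvd' (Nat.one_le_pow _ _ (by omega))).1 ?_
    simpa using (hQ.pow (m + 1)).symm

/-- Over every finite field with `n ∣ q - 1`, the lifted MBR code evaluated at the powers of a
primitive `n`-th root of unity has all the claimed properties; and for a fixed local length `nl`
the field size can be taken linear in `n`. -/
theorem mainTheorem1 (nl : ℕ) :
    (∀ n r d β K : ℕ, AdmissibleParams n nl r d β K →
      ∀ (F : Type*) [Field F] [Fintype F], n ∣ Fintype.card F - 1 →
        (∃ γ : F, IsPrimitiveRoot γ n) ∧
        ∀ γ : F, IsPrimitiveRoot γ n →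
          IsOptimalMBRLocalityCode n nl r d β K (fun t : Fin n => γ ^ (t : ℕ))
            (liftedMBRCode n nl r d β K (fun t : Fin n => γ ^ (t : ℕ)))) ∧
    (∃ c : ℕ, ∀ n r d β K : ℕ, AdmissibleParams n nl r d β K →
      ∃ (F : Type) (_ : Field F) (_ : Fintype F), Fintype.card F ≤ c * n ∧
        ∃ x : Fin n → F,
          IsOptimalMBRLocalityCode n nl r d β K x (liftedMBRCode n nl r d β K x)) := by
  constructor
  · intro n r d β K hP F _ _ hF
    refine ⟨exists_isPrimitiveRoot_of_dvd hF, fun γ hγ => ?_⟩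
    refine isOptimalMBRLocalityCode_of_isPrimitiveRoot hP (m := n / nl) (g := γ) ?_ le_rfl
      fun t => ?_
    · rwa [Nat.div_mul_cancel hP.nl_dvd_n]
    · rw [mul_comm ((t : ℕ) / _), Nat.mod_add_div]
  · rcases Nat.eq_zero_or_pos nl with rfl | hnl
    · exact ⟨0, fun n r d β K hP => absurd hP.d_lt_nl (Nat.not_lt_zero d)⟩
    obtain ⟨c, hc⟩ := exists_field_card_le hnl
    refine ⟨c, fun n r d β K hP => ?_⟩
    obtain ⟨F, hF, hF', hle, hlt, m, hm⟩ := hc n hP.n_pos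
    obtain ⟨g, hg⟩ := exists_isPrimitiveRoot_of_dvd (F := F) (n := m * nl)
      (by rw [hm, mul_comm])
    refine ⟨F, hF, hF', hle,
      fun t => g ^ ((t : ℕ) % (n / nl) + (t : ℕ) / (n / nl) * m),
      isOptimalMBRLocalityCode_of_isPrimitiveRoot hP hg ?_ fun t => rfl⟩
    exact Nat.div_le_of_le_mul (by omega)
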